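/- For an integer $q\ge 1$ and a real number $s$ put $$\varphi_s(q)=q^s\prod_{p\mid q}\Bigl(1-\frac1{p^s}\Bigr),\qquad \kappa_s(q)=q^s\prod_{p\mid q}\Bigl(1+\frac1{p^s}\Bigr),$$ the products being over the primes dividing $q$, and write $\kappa=\kappa_1$. Let $\mu$ be the Möbius function. Then for every integer $q\ge 1$ and every real $X>0$, the series below converges and $$\left|\sum_{\substack{\ell>X\\ (\ell,q)=1}}\frac{\mu^2(\ell)}{\ell^2}-\frac{q}{\kappa(q)}\,\frac{6}{\pi^2}\,\frac1X\right|\le \frac{\sqrt q}{\varphi_{1/2}(q)}\cdot\frac{c}{X^{3/2}},$$ where $c=0.912$ if $2\nmid q$ and $c=0.238$ if $2\mid q$. -/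

import Mathlib

noncomputable section

/-- The Euler function `φ_s(q) = q^s ∏_{p ∣ q} (1 - 1/p^s)`, for a real exponent `s`. -/
def eulerPhi (s : ℝ) (q : ℕ) : ℝ :=
  (q : ℝ) ^ s * ∏ p ∈ q.primeFactors, (1 - 1 / (p : ℝ) ^ s)

/-- The kappa function `κ_s(q) = q^s ∏_{p ∣ q} (1 + 1/p^s)`, for a real exponent `s`;
the function written `κ` is `κ_1`. -/
def kappa (s : ℝ) (q : ℕ) : ℝ :=
  (q : ℝ) ^ s * ∏ p ∈ q.primeFactors, (1 + 1 / (p : ℝ) ^ s)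

end

/-! Write S_P(X) for `squarefreeTail P X`, where P is a finite set of primes. Separating the
multiples of a new prime p gives S_P(X) = S_{P∪p}(X) + p⁻² S_{P∪p}(X/p) (`squarefreeTail_split`).
Multiplied by X^(3/2), the error M of S_{P∪p} therefore satisfies M(X) ≤ B + p^(-1/2) M(X/p), with B
the constant for P. Since M is bounded on (0, 1], iteration gives M ≤ B/(1 - p^(-1/2)), while the
main coefficient is divided by 1 + 1/p. Adjoining primes one at a time
(`squarefreeTail_union_bound`) produces both products over p ∣ q, so only P = ∅ (odd q) and P = {2}
(even q) need a direct estimate.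

Both base cases rest on the constant 0.534 for P = {2} and X ≥ 1 (`abs_squarefreeTail_two_le`); P =
∅ follows from S_∅(X) = S_{2}(X) + S_{2}(X/2)/4, and small X is explicit. For X ≥ 400, the expansion
μ²(l) = ∑_{d² ∣ l} μ(d) turns S_{2}(X) into ∑ μ(d) d⁻⁴ `oddTail (X/d²)` over odd d. The terms with d
≤ √X are estimated by `abs_oddTail_sub_le`; for d > √X the tail is the full sum π²/8. For 1 ≤ X <
400, S_{2} is constant on each [2K-1, 2K+1) and integer arithmetic checks every interval. -/

open ArithmeticFunction

/-! ### Tails of the squarefree series and the adjunction of primes. -/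

/-- The sum of `μ²(n) / n²` over the integers `n > X` having no divisor in `P`. -/
noncomputable def squarefreeTail (P : Finset ℕ) (X : ℝ) : ℝ :=
  ∑' n : ℕ, Set.indicator {n : ℕ | X < n ∧ ∀ p ∈ P, ¬ p ∣ n}
    (fun n => (moebius n : ℝ) ^ 2 / (n : ℝ) ^ 2) n

lemma moebius_sq_cast (n : ℕ) :
    (moebius n : ℝ) ^ 2 = if Squarefree n then 1 else 0 := by
  have := moebius_sq (n := n)
  have h2 : (((moebius n) ^ 2 : ℤ) : ℝ) = ((if Squarefree n then 1 else 0 : ℤ) : ℝ) := by rw [this]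
  push_cast at h2
  exact h2

lemma summable_moebius_sq_div : Summable (fun n : ℕ => (moebius n : ℝ) ^ 2 / (n : ℝ) ^ 2) := by
  refine Summable.of_nonneg_of_le (fun n => by positivity) (fun n => ?_)
    (Real.summable_one_div_nat_pow.2 one_lt_two)
  rw [moebius_sq_cast]
  gcongr
  split_ifs <;> norm_num

lemma summable_squarefreeTail (P : Finset ℕ) (X : ℝ) :
    Summable (fun n : ℕ => Set.indicator {n : ℕ | X < n ∧ ∀ p ∈ P, ¬ p ∣ n}
      (fun n => (moebius n : ℝ) ^ 2 / (n : ℝ) ^ 2) n) :=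
  summable_moebius_sq_div.indicator _

lemma squarefreeTail_nonneg (P : Finset ℕ) (X : ℝ) : 0 ≤ squarefreeTail P X :=
  tsum_nonneg fun n => Set.indicator_nonneg (fun n _ => by positivity) n

lemma squarefreeTail_le (P : Finset ℕ) (X : ℝ) :
    squarefreeTail P X ≤ ∑' n : ℕ, (moebius n : ℝ) ^ 2 / (n : ℝ) ^ 2 :=
  (summable_squarefreeTail P X).tsum_le_tsum
    (fun n => Set.indicator_le_self' (fun n _ => by positivity) n) summable_moebius_sq_div

lemma moebius_sq_prime_mul {p : ℕ} (hp : p.Prime) (m : ℕ) :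
    (moebius (p * m) : ℝ) ^ 2 = if p ∣ m then 0 else (moebius m : ℝ) ^ 2 := by
  rw [moebius_sq_cast, moebius_sq_cast]
  by_cases h : p ∣ m
  · rw [if_pos h, if_neg]
    intro hs
    exact hp.not_isUnit (hs p (mul_dvd_mul_left p h))
  · simp [h, Nat.squarefree_mul ((Nat.Prime.coprime_iff_not_dvd hp).2 h), hp.squarefree]

/-- Separating the multiples of a prime in the tail of the squarefree series. -/
lemma squarefreeTail_split {P : Finset ℕ} (hP : ∀ r ∈ P, r.Prime) {p : ℕ} (hp : p.Prime)
    (hpP : p ∉ P) (X : ℝ) :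
    squarefreeTail P X =
      squarefreeTail (insert p P) X + 1 / (p : ℝ) ^ 2 * squarefreeTail (insert p P) (X / p) := by
  have hp0 : (0 : ℝ) < p := by exact_mod_cast hp.pos
  set f : ℕ → ℝ := fun n => Set.indicator {n : ℕ | X < n ∧ ∀ p ∈ P, ¬ p ∣ n}
    (fun n => (moebius n : ℝ) ^ 2 / (n : ℝ) ^ 2) n with hf
  have hfs : Summable f := summable_squarefreeTail P X
  have h1 : ∀ n, f n = Set.indicator {n : ℕ | X < n ∧ ∀ r ∈ insert p P, ¬ r ∣ n}
      (fun n => (moebius n : ℝ) ^ 2 / (n : ℝ) ^ 2) n + Set.indicator {n | p ∣ n} f n := by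
    intro n
    by_cases hn : p ∣ n <;> simp [hf, Set.indicator, hn]
  have hinj : Function.Injective (fun m : ℕ => p * m) :=
    fun a b h => Nat.eq_of_mul_eq_mul_left hp.pos h
  have h2 : ∑' n, Set.indicator {n | p ∣ n} f n = ∑' m, f (p * m) := by
    have := hinj.tsum_eq (f := Set.indicator {n | p ∣ n} f) (by
      intro n hn
      have : p ∣ n := by
        by_contra h
        exact hn (Set.indicator_of_notMem (s := {n | p ∣ n}) h f)
      obtain ⟨m, rfl⟩ := this
      exact ⟨m, rfl⟩)
    rw [← this]
    exact tsum_congr fun m => by simp [Set.indicator]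
  have h3 : ∀ m, f (p * m) = 1 / (p : ℝ) ^ 2 *
      Set.indicator {n : ℕ | X / p < n ∧ ∀ r ∈ insert p P, ¬ r ∣ n}
      (fun n => (moebius n : ℝ) ^ 2 / (n : ℝ) ^ 2) m := by
    intro m
    have e1 : X < ((p * m : ℕ) : ℝ) ↔ X / p < m := by
      rw [div_lt_iff₀ hp0]; push_cast; rw [mul_comm]
    have e2 : (∀ r ∈ P, ¬ r ∣ p * m) ↔ ∀ r ∈ P, ¬ r ∣ m := by
      refine forall₂_congr fun r hr => not_congr ?_
      rw [(hP r hr).dvd_mul]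
      refine or_iff_right fun h => hpP ?_
      rwa [← (Nat.prime_dvd_prime_iff_eq (hP r hr) hp).1 h]
    simp only [hf, Set.indicator, Set.mem_ofPred_eq, e1, e2, Finset.forall_mem_insert,
      moebius_sq_prime_mul hp]
    by_cases h : p ∣ m
    · simp [h]
    · simp only [h, not_false_eq_true, true_and, if_false]
      split_ifs
      · push_cast; field_simp
      · simp
  unfold squarefreeTail
  rw [show (∑' n : ℕ, Set.indicator {n : ℕ | X < n ∧ ∀ p ∈ P, ¬ p ∣ n}
    (fun n => (moebius n : ℝ) ^ 2 / (n : ℝ) ^ 2) n) = ∑' n, f n from rfl, tsum_congr h1,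
    (summable_squarefreeTail (insert p P) X).tsum_add (hfs.indicator _), h2, tsum_congr h3,
    tsum_mul_left]

/-- A function contracted by the scaling `X ↦ X / p` and bounded near zero is bounded. -/
lemma le_div_one_sub_of_contraction {M : ℝ → ℝ} {B C r p : ℝ} (hp : 1 < p) (hr : 0 ≤ r)
    (hr1 : r < 1) (hC : ∀ X, 0 < X → X ≤ 1 → M X ≤ C)
    (h : ∀ X, 0 < X → M X ≤ B + r * M (X / p)) {X : ℝ} (hX : 0 < X) : M X ≤ B / (1 - r) := by
  have hp0 : 0 < p := by linarith
  -- B/(1 - r) is the fixed point of m ↦ B + r m, so each iteration multiplies the excess over it by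
  -- r.
  have key : ∀ k : ℕ, M X ≤ B / (1 - r) + r ^ k * (M (X / p ^ k) - B / (1 - r)) := by
    intro k
    induction k with
    | zero => simp
    | succ k ih =>
      have hk := h (X / p ^ k) (by positivity)
      have : r ^ k * M (X / p ^ k) ≤ r ^ k * (B + r * M (X / p ^ k / p)) := by gcongr
      have e : X / p ^ k / p = X / p ^ (k + 1) := by rw [div_div, pow_succ]
      rw [e] at this
      have e2 : B = B / (1 - r) * (1 - r) := by
        rw [div_mul_cancel₀]; linarith
      have e3 : r ^ k * B = r ^ k * (B / (1 - r) * (1 - r)) := by rw [← e2]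
      rw [pow_succ r k]
      nlinarith
  have hlim : Filter.Tendsto (fun k : ℕ => B / (1 - r) + r ^ k * (C - B / (1 - r)))
      Filter.atTop (nhds (B / (1 - r) + 0 * (C - B / (1 - r)))) :=
    ((tendsto_pow_atTop_nhds_zero_of_lt_one hr hr1).mul_const _).const_add _
  rw [zero_mul, add_zero] at hlim
  refine ge_of_tendsto hlim ?_
  obtain ⟨K, hK⟩ := pow_unbounded_of_one_lt X hp
  filter_upwards [Filter.eventually_ge_atTop K] with k hk
  refine (key k).trans ?_
  have h1 : X / p ^ k ≤ 1 := by
    rw [div_le_one (by positivity)]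
    exact hK.le.trans (pow_le_pow_right₀ hp.le hk)
  have := hC (X / p ^ k) (by positivity) h1
  gcongr

/-- Since p⁻² X^(3/2) = p^(-1/2) (X/p)^(3/2), the splitting identity makes the normalised error a
contraction of ratio p^(-1/2). Near zero that error is bounded trivially by the full series plus
|A'|. -/
lemma squarefreeTail_insert_bound {P : Finset ℕ} (hP : ∀ r ∈ P, r.Prime) {p : ℕ} (hp : p.Prime)
    (hpP : p ∉ P) {A B : ℝ}
    (h : ∀ X : ℝ, 0 < X → |squarefreeTail P X - A / X| ≤ B / X ^ (3 / 2 : ℝ))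
    {X : ℝ} (hX : 0 < X) :
    |squarefreeTail (insert p P) X - A / (1 + 1 / p) / X|
      ≤ B / (1 - 1 / (p : ℝ) ^ (1 / 2 : ℝ)) / X ^ (3 / 2 : ℝ) := by
  have hp1 : (1 : ℝ) < p := by exact_mod_cast hp.one_lt
  have hp0 : (0 : ℝ) < p := by linarith
  set A' := A / (1 + 1 / (p : ℝ)) with hA'
  have hAA : A = A' + A' / p := by
    rw [hA']; field_simp
  set M : ℝ → ℝ := fun X => |squarefreeTail (insert p P) X - A' / X| * X ^ (3 / 2 : ℝ) with hM
  have hpr : 1 < (p : ℝ) ^ (1 / 2 : ℝ) := Real.one_lt_rpow hp1 (by norm_num)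
  have hMX : M X ≤ B / (1 - 1 / (p : ℝ) ^ (1 / 2 : ℝ)) := by
    refine le_div_one_sub_of_contraction (C := (∑' n : ℕ, (moebius n : ℝ) ^ 2 / (n : ℝ) ^ 2) + |A'|)
      hp1 (by positivity) ?_ ?_ ?_ hX
    · rw [div_lt_one (by positivity)]; exact hpr
    · intro Y hY hY1
      have hr1 : Y ^ (3 / 2 : ℝ) ≤ 1 := Real.rpow_le_one hY.le hY1 (by norm_num)
      have hr2 : Y ^ (3 / 2 : ℝ) ≤ Y := by
        have := Real.rpow_le_rpow_of_exponent_ge hY hY1 (show (1 : ℝ) ≤ 3 / 2 by norm_num)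
        simpa using this
      have h0 : 0 ≤ Y ^ (3 / 2 : ℝ) := by positivity
      have hs := squarefreeTail_nonneg (insert p P) Y
      calc M Y ≤ (|squarefreeTail (insert p P) Y| + |A' / Y|) * Y ^ (3 / 2 : ℝ) := by
            simp only [hM]; gcongr; exact abs_sub _ _
        _ = squarefreeTail (insert p P) Y * Y ^ (3 / 2 : ℝ) + |A'| / Y * Y ^ (3 / 2 : ℝ) := by
            rw [abs_of_nonneg hs, abs_div, abs_of_pos hY]; ring
        _ ≤ squarefreeTail (insert p P) Y * 1 + |A'| / Y * Y := by gcongr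
        _ ≤ _ := by
            rw [mul_one, div_mul_cancel₀ _ hY.ne']
            gcongr
            exact squarefreeTail_le _ _
    · intro Y hY
      have e := squarefreeTail_split hP hp hpP Y
      have hb := h Y hY
      have hY32 : 0 < Y ^ (3 / 2 : ℝ) := by positivity
      rw [le_div_iff₀ hY32] at hb
      have e2 : squarefreeTail (insert p P) Y - A' / Y = (squarefreeTail P Y - A / Y) -
          1 / (p : ℝ) ^ 2 * (squarefreeTail (insert p P) (Y / p) - A' / (Y / p)) := by
        rw [e, hAA]; field_simp; ring
      have e3 : 1 / (p : ℝ) ^ 2 * Y ^ (3 / 2 : ℝ)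
          = 1 / (p : ℝ) ^ (1 / 2 : ℝ) * (Y / p) ^ (3 / 2 : ℝ) := by
        rw [Real.div_rpow hY.le hp0.le]
        have : (p : ℝ) ^ 2 = (p : ℝ) ^ (1 / 2 : ℝ) * (p : ℝ) ^ (3 / 2 : ℝ) := by
          rw [← Real.rpow_add hp0, ← Real.rpow_natCast]; norm_num
        rw [this]; field_simp
      simp only [hM]
      rw [e2]
      calc _ ≤ (|squarefreeTail P Y - A / Y| +
              |1 / (p : ℝ) ^ 2 * (squarefreeTail (insert p P) (Y / p) - A' / (Y / p))|)
              * Y ^ (3 / 2 : ℝ) := by gcongr; exact abs_sub _ _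
        _ = |squarefreeTail P Y - A / Y| * Y ^ (3 / 2 : ℝ) + (1 / (p : ℝ) ^ 2 * Y ^ (3 / 2 : ℝ))
              * |squarefreeTail (insert p P) (Y / p) - A' / (Y / p)| := by
            rw [abs_mul, abs_of_pos (show 0 < 1 / (p : ℝ) ^ 2 by positivity)]; ring
        _ ≤ _ := by rw [e3]; nlinarith
  rw [le_div_iff₀ (by positivity)]
  exact hMX

lemma squarefreeTail_union_bound {P : Finset ℕ} (hP : ∀ r ∈ P, r.Prime) {A B : ℝ}
    (h : ∀ X : ℝ, 0 < X → |squarefreeTail P X - A / X| ≤ B / X ^ (3 / 2 : ℝ)) (Q : Finset ℕ)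
    (hQ : ∀ r ∈ Q, r.Prime) (hPQ : Disjoint P Q) (X : ℝ) (hX : 0 < X) :
    |squarefreeTail (P ∪ Q) X - A / (∏ p ∈ Q, (1 + 1 / (p : ℝ))) / X|
      ≤ B / (∏ p ∈ Q, (1 - 1 / (p : ℝ) ^ (1 / 2 : ℝ))) / X ^ (3 / 2 : ℝ) := by
  induction Q using Finset.induction_on generalizing X with
  | empty => simpa using h X hX
  | insert p Q hpQ ih =>
    rw [Finset.disjoint_insert_right] at hPQ
    rw [Finset.forall_mem_insert] at hQ
    have := squarefreeTail_insert_bound (P := P ∪ Q) (p := p)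
      (fun r hr => (Finset.mem_union.1 hr).elim (hP r) (hQ.2 r)) hQ.1
      (by simp [hPQ.1, hpQ]) (fun X hX => ih hQ.2 hPQ.2 X hX) hX
    rw [Finset.prod_insert hpQ, Finset.prod_insert hpQ, Finset.union_insert, mul_comm,
      mul_comm (1 - 1 / (p : ℝ) ^ (1 / 2 : ℝ)), ← div_div, ← div_div]
    exact this

/-! ### Zeta and Möbius series over odd integers. -/

lemma injective_two_mul_add_one : Function.Injective (fun j : ℕ => 2 * j + 1) :=
  fun a b h => by simpa using h

lemma summable_one_div_odd_pow {k : ℕ} (hk : 1 < k) :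
    Summable (fun j : ℕ => 1 / (2 * (j : ℝ) + 1) ^ k) := by
  have := (Real.summable_one_div_nat_pow.2 hk).comp_injective injective_two_mul_add_one
  refine this.congr fun j => ?_
  simp

lemma tsum_one_div_odd_sq : ∑' j : ℕ, 1 / (2 * (j : ℝ) + 1) ^ 2 = Real.pi ^ 2 / 8 := by
  have hs := Real.summable_one_div_nat_pow.2 one_lt_two
  have h := tsum_even_add_odd (f := fun n : ℕ => 1 / (n : ℝ) ^ 2)
    (hs.comp_injective (fun a b h => by simpa using h))
    (hs.comp_injective injective_two_mul_add_one)
  rw [hasSum_zeta_two.tsum_eq] at h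
  have e : ∑' k : ℕ, 1 / ((2 * k : ℕ) : ℝ) ^ 2 = 1 / 4 * (Real.pi ^ 2 / 6) := by
    rw [← hasSum_zeta_two.tsum_eq, ← tsum_mul_left]
    refine tsum_congr fun k => ?_
    push_cast
    rw [mul_pow, one_div_mul_one_div]
    norm_num
  rw [e] at h
  push_cast at h
  linarith

lemma summable_moebius_div_pow {k : ℕ} (hk : 1 < k) :
    Summable (fun n : ℕ => (moebius n : ℝ) / (n : ℝ) ^ k) := by
  refine Summable.of_norm_bounded (Real.summable_one_div_nat_pow.2 hk) fun n => ?_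
  rw [norm_div, Real.norm_eq_abs, Real.norm_of_nonneg (by positivity : (0 : ℝ) ≤ (n : ℝ) ^ k)]
  gcongr
  exact_mod_cast abs_moebius_le_one (n := n)

lemma tsum_moebius_div_pow {k : ℕ} (hk : 1 < k) {z : ℝ}
    (hz : HasSum (fun n : ℕ => 1 / (n : ℝ) ^ k) z) :
    ∑' n : ℕ, (moebius n : ℝ) / (n : ℝ) ^ k = 1 / z := by
  have hk' : (1 : ℝ) < ((k : ℕ) : ℂ).re := by simpa using hk
  have h1 := LSeries_one_mul_Lseries_moebius hk'
  have e1 : LSeries 1 (k : ℂ) = (z : ℂ) := by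
    rw [← hz.tsum_eq, LSeries, Complex.ofReal_tsum]
    refine tsum_congr fun n => ?_
    rcases eq_or_ne n 0 with rfl | hn
    · simp [show k ≠ 0 by omega]
    · rw [LSeries.term_of_ne_zero hn]; simp
  have e2 : LSeries (fun n => ((moebius n : ℤ) : ℂ)) (k : ℂ)
      = ((∑' n : ℕ, (moebius n : ℝ) / (n : ℝ) ^ k : ℝ) : ℂ) := by
    rw [LSeries, Complex.ofReal_tsum]
    refine tsum_congr fun n => ?_
    rcases eq_or_ne n 0 with rfl | hn
    · simp
    · rw [LSeries.term_of_ne_zero hn]; simp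
  rw [e1, e2] at h1
  have h2 : z * (∑' n : ℕ, (moebius n : ℝ) / (n : ℝ) ^ k) = 1 := by exact_mod_cast h1
  rw [eq_div_iff (left_ne_zero_of_mul_eq_one h2), mul_comm, h2]

lemma moebius_two_mul_odd (j : ℕ) : moebius (2 * (2 * j + 1)) = -moebius (2 * j + 1) := by
  rw [isMultiplicative_moebius.map_mul_of_coprime (by simp), moebius_apply_prime Nat.prime_two]
  ring

lemma moebius_two_mul_even (j : ℕ) : moebius (2 * (2 * j)) = 0 := by
  refine moebius_eq_zero_of_not_squarefree fun h => ?_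
  have := h 2 ⟨j, by ring⟩
  exact absurd this (by decide)

/-- The terms n ≡ 0 mod 4 vanish and those with n = 2m, m odd, give -2^(-k) times the odd series. -/
lemma tsum_moebius_odd_div_pow {k : ℕ} (hk : 1 < k) :
    (1 - 1 / 2 ^ k) * ∑' j : ℕ, (moebius (2 * j + 1) : ℝ) / (2 * (j : ℝ) + 1) ^ k
      = ∑' n : ℕ, (moebius n : ℝ) / (n : ℝ) ^ k := by
  have hs := summable_moebius_div_pow hk
  have hev : Function.Injective (fun j : ℕ => 2 * j) := fun a b h => by simpa using h
  have h := tsum_even_add_odd (f := fun n : ℕ => (moebius n : ℝ) / (n : ℝ) ^ k)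
    (hs.comp_injective hev) (hs.comp_injective injective_two_mul_add_one)
  have hs2 := hs.comp_injective hev
  have h2 := tsum_even_add_odd (f := fun n : ℕ => (moebius (2 * n) : ℝ) / ((2 * n : ℕ) : ℝ) ^ k)
    (hs2.comp_injective hev) (hs2.comp_injective injective_two_mul_add_one)
  have e1 : ∑' j : ℕ, (moebius (2 * (2 * j)) : ℝ) / ((2 * (2 * j) : ℕ) : ℝ) ^ k = 0 := by
    simp [moebius_two_mul_even]
  have e2 : ∑' j : ℕ, (moebius (2 * (2 * j + 1)) : ℝ) / ((2 * (2 * j + 1) : ℕ) : ℝ) ^ k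
      = -(1 / 2 ^ k) * ∑' j : ℕ, (moebius (2 * j + 1) : ℝ) / (2 * (j : ℝ) + 1) ^ k := by
    rw [← tsum_mul_left]
    refine tsum_congr fun j => ?_
    rw [moebius_two_mul_odd]
    push_cast
    rw [mul_pow]
    field_simp
  rw [e1, e2, zero_add] at h2
  rw [← h, ← h2]
  push_cast
  ring

lemma tsum_moebius_odd_div_sq :
    ∑' j : ℕ, (moebius (2 * j + 1) : ℝ) / (2 * (j : ℝ) + 1) ^ 2 = 8 / Real.pi ^ 2 := by
  have h := tsum_moebius_odd_div_pow one_lt_two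
  rw [tsum_moebius_div_pow one_lt_two hasSum_zeta_two] at h
  have : (0 : ℝ) < Real.pi := Real.pi_pos
  have e : (8 : ℝ) / Real.pi ^ 2 = 4 / 3 * (1 / (Real.pi ^ 2 / 6)) := by field_simp; norm_num
  rw [e, ← h]; ring

lemma tsum_moebius_odd_div_pow_four :
    ∑' j : ℕ, (moebius (2 * j + 1) : ℝ) / (2 * (j : ℝ) + 1) ^ 4 = 96 / Real.pi ^ 4 := by
  have h := tsum_moebius_odd_div_pow (k := 4) (by norm_num)
  rw [tsum_moebius_div_pow (by norm_num) hasSum_zeta_four] at h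
  have : (0 : ℝ) < Real.pi := Real.pi_pos
  have e : (96 : ℝ) / Real.pi ^ 4 = 16 / 15 * (1 / (Real.pi ^ 4 / 90)) := by field_simp; norm_num
  rw [e, ← h]; ring

/-! ### Möbius expansion of the odd squarefree tail. -/

lemma sq_dvd_sq_mul_squarefree {a b d : ℕ} (hb : 0 < b) (ha : Squarefree a) :
    d ^ 2 ∣ b ^ 2 * a ↔ d ∣ b := by
  refine ⟨fun h => ?_, fun h => (pow_dvd_pow_of_dvd h 2).mul_right a⟩
  have hg : 0 < d.gcd b := Nat.gcd_pos_of_pos_right d hb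
  obtain ⟨g, d', b', hg0, hco, rfl, rfl⟩ := Nat.exists_coprime' hg
  rw [mul_pow, mul_pow, mul_right_comm] at h
  have h2 := Nat.dvd_of_mul_dvd_mul_right (pow_pos hg0 2) h
  have h3 := (Nat.Coprime.pow 2 2 hco).dvd_of_dvd_mul_left h2
  have h4 : d' = 1 := Nat.isUnit_iff.1 (ha d' (by rwa [← sq]))
  simp [h4]

/-- With 2l + 1 = b²a and a squarefree, d² divides 2l + 1 exactly when d ∣ b, and ∑_{d ∣ b} μ(d) is
the indicator of b = 1. -/
lemma hasSum_moebius_sq_dvd (l : ℕ) :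
    HasSum (fun j : ℕ => if (2 * j + 1) ^ 2 ∣ 2 * l + 1 then (moebius (2 * j + 1) : ℝ) else 0)
      ((moebius (2 * l + 1) : ℝ) ^ 2) := by
  obtain ⟨a, b, ha, hb, hab, hsq⟩ := Nat.sq_mul_squarefree_of_pos (Nat.succ_pos (2 * l))
  rw [Nat.succ_eq_add_one] at hab
  set h : ℕ → ℝ := fun d => if d ∈ b.divisors then (moebius d : ℝ) else 0 with hh
  have h1 : HasSum h (∑ d ∈ b.divisors, (moebius d : ℝ)) := by
    have : HasSum h (∑ d ∈ b.divisors, h d) := hasSum_sum_of_ne_finset_zero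
      (fun d hd => by simp only [hh]; rw [if_neg hd])
    rwa [show ∑ d ∈ b.divisors, h d = ∑ d ∈ b.divisors, (moebius d : ℝ) from
      Finset.sum_congr rfl fun d hd => by simp only [hh]; rw [if_pos hd]] at this
  have h2 : ∑ d ∈ b.divisors, (moebius d : ℝ) = (moebius (2 * l + 1) : ℝ) ^ 2 := by
    have e1 : ∑ d ∈ b.divisors, moebius d = if b = 1 then 1 else 0 := by
      rw [← coe_mul_zeta_apply, moebius_mul_coe_zeta, one_apply]
    have e2 : ∑ d ∈ b.divisors, (moebius d : ℝ) = if b = 1 then 1 else 0 := by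
      rw [← Int.cast_sum, e1]; split_ifs <;> simp
    rw [e2, moebius_sq_cast]
    refine if_congr ?_ rfl rfl
    rw [← hab]
    constructor
    · rintro rfl; simpa using hsq
    · intro hs
      exact Nat.isUnit_iff.1 (hs b ⟨a, by ring⟩)
  rw [← h2]
  have h3 := (injective_two_mul_add_one.hasSum_iff (f := h) (a := ∑ d ∈ b.divisors, (moebius d : ℝ))
    (by
      intro d hd
      simp only [hh]
      refine if_neg fun hdb => hd ?_
      have hdl : d ∣ 2 * l + 1 := by
        rw [← hab]
        exact ((Nat.dvd_of_mem_divisors hdb).trans (dvd_pow_self b two_ne_zero)).mul_right a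
      obtain ⟨j, hj⟩ := Odd.of_dvd_nat (odd_two_mul_add_one l) hdl
      exact ⟨j, hj.symm⟩)).2 h1
  refine h3.congr_fun fun j => ?_
  simp only [hh, Function.comp]
  refine if_congr ?_ rfl rfl
  rw [← hab, sq_dvd_sq_mul_squarefree hb hsq, Nat.mem_divisors]
  simp [hb.ne']

/-- The sum of `1 / m²` over the odd integers `m > y`. -/
noncomputable def oddTail (y : ℝ) : ℝ :=
  ∑' l : ℕ, if y < 2 * (l : ℝ) + 1 then 1 / (2 * (l : ℝ) + 1) ^ 2 else 0

lemma squarefreeTail_two (X : ℝ) : squarefreeTail {2} X =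
    ∑' l : ℕ, if X < 2 * (l : ℝ) + 1 then
      (moebius (2 * l + 1) : ℝ) ^ 2 / (2 * (l : ℝ) + 1) ^ 2 else 0 := by
  unfold squarefreeTail
  rw [← injective_two_mul_add_one.tsum_eq]
  · refine tsum_congr fun l => ?_
    simp only [Set.indicator, Set.mem_ofPred_eq, Finset.mem_singleton, forall_eq]
    push_cast
    refine if_congr ?_ rfl rfl
    simp
  · intro n hn
    have : n ∈ {n : ℕ | X < n ∧ ∀ p ∈ ({2} : Finset ℕ), ¬ p ∣ n} := by
      by_contra h
      exact hn (Set.indicator_of_notMem h _)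
    have h2 : ¬ 2 ∣ n := this.2 2 (by simp)
    exact ⟨n / 2, by simp only; omega⟩

/-- The squarefree tail over odd integers as a Möbius sum of tails over odd integers. -/
lemma squarefreeTail_two_eq_tsum (X : ℝ) : squarefreeTail {2} X =
    ∑' j : ℕ, (moebius (2 * j + 1) : ℝ) / (2 * (j : ℝ) + 1) ^ 4
      * oddTail (X / (2 * (j : ℝ) + 1) ^ 2) := by
  set G : ℕ → ℕ → ℝ := fun l j => if (2 * j + 1) ^ 2 ∣ 2 * l + 1 then
    (if X < 2 * (l : ℝ) + 1 then (moebius (2 * j + 1) : ℝ) / (2 * (l : ℝ) + 1) ^ 2 else 0) else 0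
    with hG
  -- The index i satisfies 2i + 1 = (2j+1)²(2k+1): it enumerates the odd multiples of (2j+1)², which
  -- allows the double sum to be exchanged.
  set i : ℕ → ℕ → ℕ := fun j k => (2 * j ^ 2 + 2 * j) * (2 * k + 1) + k with hi
  have hi1 : ∀ j k, 2 * i j k + 1 = (2 * j + 1) ^ 2 * (2 * k + 1) := fun j k => by
    simp only [hi]; ring
  have hi1r : ∀ j k : ℕ, 2 * (i j k : ℝ) + 1 = (2 * (j : ℝ) + 1) ^ 2 * (2 * k + 1) := fun j k => by
    exact_mod_cast hi1 j k
  have hinj : ∀ j, Function.Injective (i j) := by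
    intro j a b hab
    have : (2 * j + 1) ^ 2 * (2 * a + 1) = (2 * j + 1) ^ 2 * (2 * b + 1) := by
      rw [← hi1, ← hi1, hab]
    have := Nat.eq_of_mul_eq_mul_left (by positivity) this
    omega
  have hrange : ∀ l j, G l j ≠ 0 → ∃ k, i j k = l := by
    intro l j h
    have hd : (2 * j + 1) ^ 2 ∣ 2 * l + 1 := by
      by_contra hd
      exact h (by simp only [hG]; rw [if_neg hd])
    obtain ⟨c, hc⟩ := hd
    obtain ⟨k, rfl⟩ := Odd.of_dvd_nat (odd_two_mul_add_one l) ⟨(2 * j + 1) ^ 2, hc.trans (mul_comm _ _)⟩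
    refine ⟨k, ?_⟩
    have := hi1 j k
    omega
  have hGi : ∀ j k : ℕ, G (i j k) j = (moebius (2 * j + 1) : ℝ) / (2 * (j : ℝ) + 1) ^ 4 *
      if X / (2 * (j : ℝ) + 1) ^ 2 < 2 * (k : ℝ) + 1 then 1 / (2 * (k : ℝ) + 1) ^ 2 else 0 := by
    intro j k
    simp only [hG]
    rw [if_pos ⟨_, hi1 j k⟩, hi1r, mul_ite, mul_zero]
    refine if_congr ?_ ?_ rfl
    · rw [div_lt_iff₀ (by positivity), mul_comm]
    · field_simp
  have hsum : Summable (Function.uncurry G) := by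
    set Φ : ℕ × ℕ → ℕ × ℕ := fun x => (i x.1 x.2, x.1) with hΦ
    have hΦi : Function.Injective Φ := by
      rintro ⟨j, k⟩ ⟨j', k'⟩ h
      simp only [hΦ, Prod.mk.injEq] at h
      obtain ⟨h1, rfl⟩ := h
      rw [hinj j h1]
    rw [← hΦi.summable_iff]
    · refine Summable.of_norm_bounded
        ((summable_one_div_odd_pow (k := 4) (by norm_num)).mul_of_nonneg
          (summable_one_div_odd_pow one_lt_two) (fun _ => by positivity) (fun _ => by positivity)) ?_
      rintro ⟨j, k⟩
      simp only [hΦ, Function.comp, Function.uncurry, hGi]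
      rw [norm_mul, norm_div, Real.norm_of_nonneg (by positivity : (0 : ℝ) ≤ (2 * (j : ℝ) + 1) ^ 4)]
      have hm : ‖(moebius (2 * j + 1) : ℝ)‖ ≤ 1 := by
        rw [Real.norm_eq_abs]
        exact_mod_cast abs_moebius_le_one (n := 2 * j + 1)
      gcongr
      split_ifs
      · rw [Real.norm_of_nonneg (by positivity)]
      · rw [norm_zero]; positivity
    · rintro ⟨l, j⟩ h
      by_contra h0
      obtain ⟨k, rfl⟩ := hrange l j h0
      exact h ⟨(j, k), rfl⟩
  have hrow : ∀ l : ℕ, ∑' j, G l j = if X < 2 * (l : ℝ) + 1 then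
      (moebius (2 * l + 1) : ℝ) ^ 2 / (2 * (l : ℝ) + 1) ^ 2 else 0 := by
    intro l
    split_ifs with hX
    · rw [← ((hasSum_moebius_sq_dvd l).div_const _).tsum_eq]
      refine tsum_congr fun j => ?_
      simp only [hG, if_pos hX]
      split_ifs <;> simp
    · rw [← tsum_zero (β := ℕ)]
      exact tsum_congr fun j => by simp [hG, hX]
  rw [squarefreeTail_two, ← tsum_congr hrow, ← hsum.tsum_comm]
  refine tsum_congr fun j => ?_
  rw [oddTail, ← tsum_mul_left, ← tsum_congr (hGi j)]
  exact ((hinj j).tsum_eq fun l hl => hrange l j hl).symm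

/-! ### Tails of odd power sums, by telescoping comparison. -/

lemma tsum_nat_add_le_of_le_sub {f H : ℕ → ℝ} {K : ℕ} (hf : ∀ l, 0 ≤ f l) (hH : ∀ l, 0 ≤ H l)
    (h : ∀ l, K ≤ l → f l ≤ H l - H (l + 1)) : ∑' l, f (l + K) ≤ H K := by
  refine Real.tsum_le_of_sum_range_le (fun l => hf _) fun n => ?_
  have : ∑ i ∈ Finset.range n, f (i + K) ≤ H K - H (n + K) := by
    induction n with
    | zero => simp
    | succ n ih =>
      rw [Finset.sum_range_succ]
      have := h (n + K) (Nat.le_add_left _ _)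
      rw [show n + 1 + K = n + K + 1 by ring]
      linarith
  linarith [hH (n + K)]

lemma le_tsum_nat_add_of_sub_le {f L : ℕ → ℝ} {K : ℕ} (hf : Summable f)
    (hL : Filter.Tendsto L Filter.atTop (nhds 0))
    (h : ∀ l, K ≤ l → L l - L (l + 1) ≤ f l) : L K ≤ ∑' l, f (l + K) := by
  have h1 := ((summable_nat_add_iff K).2 hf).hasSum.tendsto_sum_nat
  have h2 : Filter.Tendsto (fun n => L K - L (n + K)) Filter.atTop (nhds (L K - 0)) :=
    (hL.comp (Filter.tendsto_add_atTop_nat K)).const_sub _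
  rw [sub_zero] at h2
  refine le_of_tendsto_of_tendsto' h2 h1 fun n => ?_
  induction n with
  | zero => simp
  | succ n ih =>
    rw [Finset.sum_range_succ]
    have := h (n + K) (Nat.le_add_left _ _)
    rw [show n + 1 + K = n + K + 1 by ring]
    linarith

/-- Midpoint rule for a convex function: the bound is half of ∫ x⁻² over x > 2K. -/
lemma tsum_odd_sq_le {K : ℕ} (hK : 0 < K) :
    ∑' l : ℕ, 1 / (2 * ((l + K : ℕ) : ℝ) + 1) ^ 2 ≤ 1 / (4 * (K : ℝ)) := by
  refine tsum_nat_add_le_of_le_sub (f := fun l : ℕ => 1 / (2 * (l : ℝ) + 1) ^ 2)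
    (H := fun l : ℕ => 1 / (4 * (l : ℝ))) (fun l => by positivity) (fun l => by positivity) ?_
  intro l hl
  have hx : (0 : ℝ) < l := by exact_mod_cast hK.trans_le hl
  push_cast
  rw [div_sub_div _ _ (by positivity) (by positivity), div_le_div_iff₀ (by positivity) (by positivity)]
  nlinarith

lemma tsum_odd_pow_six_le {K : ℕ} (hK : 0 < K) :
    ∑' l : ℕ, 1 / (2 * ((l + K : ℕ) : ℝ) + 1) ^ 6 ≤ 1 / (10 * (2 * (K : ℝ)) ^ 5) := by
  refine tsum_nat_add_le_of_le_sub (f := fun l : ℕ => 1 / (2 * (l : ℝ) + 1) ^ 6)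
    (H := fun l : ℕ => 1 / (10 * (2 * (l : ℝ)) ^ 5)) (fun l => by positivity)
    (fun l => by positivity) ?_
  intro l hl
  have hx : (0 : ℝ) < l := by exact_mod_cast hK.trans_le hl
  push_cast
  obtain ⟨x, hx2⟩ : ∃ x : ℝ, x = 2 * l := ⟨_, rfl⟩
  rw [mul_add, ← hx2, mul_one]
  have hx0 : 0 < x := by linarith
  rw [div_sub_div _ _ (by positivity) (by positivity), div_le_div_iff₀ (by positivity) (by positivity),
    ← sub_nonneg]
  ring_nf
  positivity

lemma tendsto_div_odd_pow (a b : ℝ) {k : ℕ} (hk : 1 < k) :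
    Filter.Tendsto (fun l : ℕ => (a * (2 * (l : ℝ) + 1) + b) / (2 * (l : ℝ) + 1) ^ k)
      Filter.atTop (nhds 0) := by
  have h0 : Filter.Tendsto (fun l : ℕ => (2 * (l : ℝ) + 1)) Filter.atTop Filter.atTop :=
    Filter.tendsto_atTop_add_const_right _ _
      (tendsto_natCast_atTop_atTop.const_mul_atTop two_pos)
  have h1 : Filter.Tendsto (fun x : ℝ => a * (1 / x ^ (k - 1)) + b * (1 / x ^ k))
      Filter.atTop (nhds (a * 0 + b * 0)) := by
    simp only [one_div]
    exact ((tendsto_inv_atTop_zero.comp (Filter.tendsto_pow_atTop (by omega))).const_mul a).add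
      ((tendsto_inv_atTop_zero.comp (Filter.tendsto_pow_atTop (by omega))).const_mul b)
  have h2 := h1.comp h0
  simp only [mul_zero, add_zero] at h2
  refine h2.congr fun l => ?_
  simp only [Function.comp]
  obtain ⟨m, rfl⟩ : ∃ m, k = m + 1 := ⟨k - 1, by omega⟩
  have : (0 : ℝ) < 2 * (l : ℝ) + 1 := by positivity
  rw [Nat.add_sub_cancel, pow_succ]
  field_simp

/-- Trapezoid rule for a convex function: with m = 2K + 1 the bound is 1/(2m) + 1/(2m²), half the
integral plus half the first term. -/
lemma le_tsum_odd_sq (K : ℕ) :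
    (2 * (K : ℝ) + 2) / (2 * (2 * (K : ℝ) + 1) ^ 2)
      ≤ ∑' l : ℕ, 1 / (2 * ((l + K : ℕ) : ℝ) + 1) ^ 2 := by
  refine le_tsum_nat_add_of_sub_le (f := fun l : ℕ => 1 / (2 * (l : ℝ) + 1) ^ 2)
    (L := fun l : ℕ => (2 * (l : ℝ) + 2) / (2 * (2 * (l : ℝ) + 1) ^ 2))
    (summable_one_div_odd_pow one_lt_two) ?_ ?_
  · refine (tendsto_div_odd_pow (1 / 2) (1 / 2) one_lt_two).congr fun l => ?_
    have : (0 : ℝ) < 2 * (l : ℝ) + 1 := by positivity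
    field_simp
    ring
  · intro l hl
    push_cast
    rw [div_sub_div _ _ (by positivity) (by positivity),
      div_le_div_iff₀ (by positivity) (by positivity), ← sub_nonneg]
    ring_nf
    positivity

lemma le_tsum_odd_pow_four (K : ℕ) :
    (2 * (K : ℝ) + 4) / (6 * (2 * (K : ℝ) + 1) ^ 4)
      ≤ ∑' l : ℕ, 1 / (2 * ((l + K : ℕ) : ℝ) + 1) ^ 4 := by
  refine le_tsum_nat_add_of_sub_le (f := fun l : ℕ => 1 / (2 * (l : ℝ) + 1) ^ 4)
    (L := fun l : ℕ => (2 * (l : ℝ) + 4) / (6 * (2 * (l : ℝ) + 1) ^ 4))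
    (summable_one_div_odd_pow (by norm_num)) ?_ ?_
  · refine (tendsto_div_odd_pow (1 / 6) (1 / 2) (k := 4) (by norm_num)).congr fun l => ?_
    have : (0 : ℝ) < 2 * (l : ℝ) + 1 := by positivity
    field_simp
    ring
  · intro l hl
    push_cast
    rw [div_sub_div _ _ (by positivity) (by positivity),
      div_le_div_iff₀ (by positivity) (by positivity), ← sub_nonneg]
    ring_nf
    positivity

lemma exists_lt_odd_iff {y : ℝ} (hy : 0 ≤ y) : ∃ K : ℕ, (∀ l : ℕ, y < 2 * (l : ℝ) + 1 ↔ K ≤ l) ∧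
    2 * (K : ℝ) - 1 ≤ y ∧ y < 2 * (K : ℝ) + 1 := by
  refine ⟨⌊(y + 1) / 2⌋₊, fun l => ?_, ?_, ?_⟩
  · rw [← Nat.lt_succ_iff, Nat.floor_lt (by linarith)]
    push_cast
    constructor <;> intro h <;> linarith
  · linarith [Nat.floor_le (show 0 ≤ (y + 1) / 2 by linarith)]
  · linarith [Nat.lt_floor_add_one ((y + 1) / 2)]

lemma tsum_ite_le_eq (f : ℕ → ℝ) (K : ℕ) :
    ∑' l, (if K ≤ l then f l else 0) = ∑' l, f (l + K) := by
  rw [← (add_left_injective K).tsum_eq]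
  · exact tsum_congr fun l => by simp
  · intro l hl
    have : K ≤ l := by
      by_contra h
      exact hl (if_neg h)
    exact ⟨l - K, Nat.sub_add_cancel this⟩

lemma oddTail_eq {y : ℝ} {K : ℕ} (h : ∀ l : ℕ, y < 2 * (l : ℝ) + 1 ↔ K ≤ l) :
    oddTail y = ∑' l : ℕ, 1 / (2 * ((l + K : ℕ) : ℝ) + 1) ^ 2 := by
  rw [oddTail, ← tsum_ite_le_eq (fun l : ℕ => 1 / (2 * (l : ℝ) + 1) ^ 2)]
  exact tsum_congr fun l => if_congr (h l) rfl rfl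

lemma oddTail_of_lt_one {y : ℝ} (hy : y < 1) : oddTail y = Real.pi ^ 2 / 8 := by
  rw [oddTail_eq (K := 0), ← tsum_one_div_odd_sq]
  · simp
  · intro l
    have : (0 : ℝ) ≤ l := by positivity
    simp only [zero_le, iff_true]
    linarith

lemma pi_sq_lt : Real.pi ^ 2 < 9.86961 := by
  nlinarith [Real.pi_gt_d6, Real.pi_lt_d6]

lemma lt_pi_sq : 9.8696 < Real.pi ^ 2 := by
  nlinarith [Real.pi_gt_d6, Real.pi_lt_d6]

lemma abs_oddTail_sub_le {y : ℝ} (hy : 1 ≤ y) : |oddTail y - 1 / (2 * y)| ≤ 5 / 8 / y ^ 2 := by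
  have hy0 : 0 < y := by linarith
  obtain ⟨K, hK, h1, h2⟩ := exists_lt_odd_iff hy0.le
  have hK1 : 1 ≤ K := by
    by_contra h
    have : K = 0 := by omega
    subst this
    norm_num at h2
    linarith
  have hKr : (1 : ℝ) ≤ K := by exact_mod_cast hK1
  have hup : oddTail y * y ^ 2 - y / 2 ≤ 5 / 8 := by
    -- The telescoped bound gives at most 1/2 + 1/(4K), which is 5/8 at K = 2 but too large at K =
    -- 1, where the exact value π²/8 - 1 is used.
    rcases hK1.eq_or_lt with rfl | hK2
    · have e : oddTail y = Real.pi ^ 2 / 8 - 1 := by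
        have hs := (summable_one_div_odd_pow one_lt_two).sum_add_tsum_nat_add 1
        rw [tsum_one_div_odd_sq] at hs
        rw [oddTail_eq hK, ← hs]
        simp
      rw [e]
      norm_num at h1 h2
      nlinarith [pi_sq_lt]
    · have hKr2 : (2 : ℝ) ≤ K := by exact_mod_cast hK2
      have hT := tsum_odd_sq_le (K := K) (by omega)
      rw [← oddTail_eq hK] at hT
      have : oddTail y * y ^ 2 ≤ 1 / (4 * K) * y ^ 2 := by gcongr
      have h4 : 1 / (4 * K) * y ^ 2 ≤ y / 2 + 5 / 8 := by
        rw [div_mul_eq_mul_div, div_le_iff₀ (by positivity)]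
        nlinarith
      linarith
  have hlo : -(5 / 8) ≤ oddTail y * y ^ 2 - y / 2 := by
    have hT := le_tsum_odd_sq K
    rw [← oddTail_eq hK] at hT
    have : (2 * (K : ℝ) + 2) / (2 * (2 * (K : ℝ) + 1) ^ 2) * y ^ 2 ≤ oddTail y * y ^ 2 := by gcongr
    have h4 : y / 2 - 5 / 8 ≤ (2 * (K : ℝ) + 2) / (2 * (2 * (K : ℝ) + 1) ^ 2) * y ^ 2 := by
      rw [div_mul_eq_mul_div, le_div_iff₀ (by positivity)]
      obtain ⟨t, rfl⟩ : ∃ t, y = 2 * K - 1 + t := ⟨y - (2 * K - 1), by ring⟩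
      have ht : 0 ≤ t := by linarith
      obtain ⟨s, hs⟩ : ∃ s : ℝ, (K : ℝ) = 1 + s := ⟨K - 1, by ring⟩
      have hs0 : 0 ≤ s := by linarith
      rw [hs]
      nlinarith [mul_nonneg hs0 ht, mul_nonneg hs0 (sq_nonneg t), mul_nonneg (sq_nonneg s) ht,
        sq_nonneg (t - 1), sq_nonneg t, mul_nonneg hs0 hs0]
    linarith
  rw [le_div_iff₀ (by positivity), ← abs_of_pos (show 0 < y ^ 2 by positivity), ← abs_mul, abs_le]
  have : (oddTail y - 1 / (2 * y)) * y ^ 2 = oddTail y * y ^ 2 - y / 2 := by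
    field_simp
  rw [this]
  exact ⟨hlo, hup⟩

/-! ### The range X ≥ 400. -/

/-- A parabola tangent to |t| at |t| = 3/(8X). It replaces the absolute value in the terms d > √X by
a polynomial in d⁻², whose sums are then estimated separately. -/
lemma abs_le_of_sq_majorant {X t : ℝ} (hX : 0 < X) : |t| ≤ 3 / (16 * X) + 4 / 3 * X * t ^ 2 := by
  have h : 0 ≤ 4 / 3 * X * (|t| - 3 / (8 * X)) ^ 2 := by positivity
  have e : 4 / 3 * X * (|t| - 3 / (8 * X)) ^ 2 = 4 / 3 * X * t ^ 2 - |t| + 3 / (16 * X) := by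
    rw [← sq_abs t]; field_simp; ring
  linarith

lemma squarefreeTail_two_sub_eq (X : ℝ) (hX : 0 < X) :
    Summable (fun j : ℕ => (moebius (2 * j + 1) : ℝ) / (2 * (j : ℝ) + 1) ^ 4
      * (oddTail (X / (2 * (j : ℝ) + 1) ^ 2) - (2 * (j : ℝ) + 1) ^ 2 / (2 * X))) ∧
    squarefreeTail {2} X - 4 / Real.pi ^ 2 / X =
    ∑' j : ℕ, (moebius (2 * j + 1) : ℝ) / (2 * (j : ℝ) + 1) ^ 4
      * (oddTail (X / (2 * (j : ℝ) + 1) ^ 2) - (2 * (j : ℝ) + 1) ^ 2 / (2 * X)) := by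
  have hμ : ∀ j : ℕ, |(moebius (2 * j + 1) : ℝ)| ≤ 1 := fun j => by
    exact_mod_cast abs_moebius_le_one (n := 2 * j + 1)
  have hT : ∀ y, 0 ≤ oddTail y ∧ oddTail y ≤ Real.pi ^ 2 / 8 := by
    intro y
    constructor
    · exact tsum_nonneg fun l => by split_ifs <;> positivity
    · rw [← tsum_one_div_odd_sq]
      have h : ∀ l : ℕ, (if y < 2 * (l : ℝ) + 1 then 1 / (2 * (l : ℝ) + 1) ^ 2 else 0)
          ≤ 1 / (2 * (l : ℝ) + 1) ^ 2 := fun l => by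
        split_ifs
        · exact le_rfl
        · positivity
      have hs := summable_one_div_odd_pow one_lt_two
      exact (Summable.of_nonneg_of_le (fun l => by split_ifs <;> positivity) h hs).tsum_le_tsum h hs
  have s1 : Summable (fun j : ℕ => (moebius (2 * j + 1) : ℝ) / (2 * (j : ℝ) + 1) ^ 4
      * oddTail (X / (2 * (j : ℝ) + 1) ^ 2)) := by
    refine Summable.of_norm_bounded
      ((summable_one_div_odd_pow (k := 4) (by norm_num)).mul_right (Real.pi ^ 2 / 8)) fun j => ?_
    rw [norm_mul, norm_div, Real.norm_eq_abs, Real.norm_eq_abs, Real.norm_eq_abs,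
      abs_of_nonneg (hT _).1, abs_of_pos (show 0 < (2 * (j : ℝ) + 1) ^ 4 by positivity)]
    have := (hT (X / (2 * (j : ℝ) + 1) ^ 2)).2
    have := (hT (X / (2 * (j : ℝ) + 1) ^ 2)).1
    have := hμ j
    gcongr
  have s2 : Summable (fun j : ℕ => 1 / (2 * X) *
      ((moebius (2 * j + 1) : ℝ) / (2 * (j : ℝ) + 1) ^ 2)) := by
    refine Summable.mul_left _ (((summable_moebius_div_pow one_lt_two).comp_injective
      injective_two_mul_add_one).congr fun j => ?_)
    simp
  have e : ∀ j : ℕ, (moebius (2 * j + 1) : ℝ) / (2 * (j : ℝ) + 1) ^ 4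
      * (oddTail (X / (2 * (j : ℝ) + 1) ^ 2) - (2 * (j : ℝ) + 1) ^ 2 / (2 * X)) =
      (moebius (2 * j + 1) : ℝ) / (2 * (j : ℝ) + 1) ^ 4 * oddTail (X / (2 * (j : ℝ) + 1) ^ 2)
      - 1 / (2 * X) * ((moebius (2 * j + 1) : ℝ) / (2 * (j : ℝ) + 1) ^ 2) := by
    intro j
    field_simp
  refine ⟨(s1.sub s2).congr fun j => (e j).symm, ?_⟩
  rw [tsum_congr e, s1.tsum_sub s2, tsum_mul_left, tsum_moebius_odd_div_sq,
    ← squarefreeTail_two_eq_tsum]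
  field_simp
  ring

/-- K counts the odd d ≤ √X. Each of these contributes at most 5/(8X²); the other three terms come
from the powers d⁻², d⁻⁴, d⁻⁶ of the parabolic majorant over d > √X. -/
lemma abs_squarefreeTail_two_le_of_odd_count {X : ℝ} (hX : 1 ≤ X) {K : ℕ} (hK0 : 0 < K)
    (hK : ∀ l : ℕ, Real.sqrt X < 2 * (l : ℝ) + 1 ↔ K ≤ l) :
    |squarefreeTail {2} X - 4 / Real.pi ^ 2 / X| ≤
      5 / 8 * K / X ^ 2 + 25 / (192 * X * K)
      - Real.pi ^ 2 / 6 * ((2 * (K : ℝ) + 4) / (6 * (2 * (K : ℝ) + 1) ^ 4))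
      + Real.pi ^ 4 / 48 * X / (10 * (2 * (K : ℝ)) ^ 5) := by
  have hX0 : 0 < X := by linarith
  obtain ⟨hs, he⟩ := squarefreeTail_two_sub_eq X hX0
  set F : ℕ → ℝ := fun j => (moebius (2 * j + 1) : ℝ) / (2 * (j : ℝ) + 1) ^ 4
      * (oddTail (X / (2 * (j : ℝ) + 1) ^ 2) - (2 * (j : ℝ) + 1) ^ 2 / (2 * X)) with hF
  have hμ : ∀ j : ℕ, |(moebius (2 * j + 1) : ℝ)| ≤ 1 := fun j => by
    exact_mod_cast abs_moebius_le_one (n := 2 * j + 1)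
  have hFle : ∀ j : ℕ, |F j| ≤ 1 / (2 * (j : ℝ) + 1) ^ 4 *
      |oddTail (X / (2 * (j : ℝ) + 1) ^ 2) - (2 * (j : ℝ) + 1) ^ 2 / (2 * X)| := by
    intro j
    rw [hF, abs_mul, abs_div, abs_of_pos (show 0 < (2 * (j : ℝ) + 1) ^ 4 by positivity)]
    have := hμ j
    gcongr
  have hlow : ∀ j, j < K → |F j| ≤ 5 / 8 / X ^ 2 := by
    intro j hj
    have h1 : 2 * (j : ℝ) + 1 ≤ Real.sqrt X := by
      by_contra h
      exact absurd ((hK j).1 (not_le.1 h)) (by omega)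
    have hd : (0 : ℝ) < 2 * (j : ℝ) + 1 := by positivity
    have h2 : (2 * (j : ℝ) + 1) ^ 2 ≤ X := by
      rw [← Real.sq_sqrt hX0.le]; gcongr
    have h3 := abs_oddTail_sub_le (y := X / (2 * (j : ℝ) + 1) ^ 2)
      ((one_le_div (by positivity)).2 h2)
    rw [show 1 / (2 * (X / (2 * (j : ℝ) + 1) ^ 2)) = (2 * (j : ℝ) + 1) ^ 2 / (2 * X) by
      field_simp] at h3
    refine (hFle j).trans ?_
    calc _ ≤ 1 / (2 * (j : ℝ) + 1) ^ 4 * (5 / 8 / (X / (2 * (j : ℝ) + 1) ^ 2) ^ 2) := by gcongr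
      _ = _ := by field_simp
  have hhigh : ∀ j, K ≤ j → |F j| ≤ 25 / (48 * X) * (1 / (2 * (j : ℝ) + 1) ^ 2)
      - Real.pi ^ 2 / 6 * (1 / (2 * (j : ℝ) + 1) ^ 4)
      + Real.pi ^ 4 / 48 * X * (1 / (2 * (j : ℝ) + 1) ^ 6) := by
    intro j hj
    have hd : (0 : ℝ) < 2 * (j : ℝ) + 1 := by positivity
    have h1 := (hK j).2 hj
    have h2 : X < (2 * (j : ℝ) + 1) ^ 2 := (Real.sqrt_lt' hd).1 h1
    have h3 := hFle j
    rw [oddTail_of_lt_one ((div_lt_one (by positivity)).2 h2)] at h3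
    refine h3.trans ?_
    have h4 := abs_le_of_sq_majorant (t := Real.pi ^ 2 / 8 / (2 * (j : ℝ) + 1) ^ 2 - 1 / (2 * X)) hX0
    have h5 : 1 / (2 * (j : ℝ) + 1) ^ 4 * |Real.pi ^ 2 / 8 - (2 * (j : ℝ) + 1) ^ 2 / (2 * X)| =
        1 / (2 * (j : ℝ) + 1) ^ 2 * |Real.pi ^ 2 / 8 / (2 * (j : ℝ) + 1) ^ 2 - 1 / (2 * X)| := by
      rw [← abs_of_pos (show 0 < 1 / (2 * (j : ℝ) + 1) ^ 4 by positivity),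
        ← abs_of_pos (show 0 < 1 / (2 * (j : ℝ) + 1) ^ 2 by positivity), ← abs_mul, ← abs_mul]
      congr 1
      field_simp
    rw [h5]
    calc _ ≤ 1 / (2 * (j : ℝ) + 1) ^ 2 * (3 / (16 * X) + 4 / 3 * X *
          (Real.pi ^ 2 / 8 / (2 * (j : ℝ) + 1) ^ 2 - 1 / (2 * X)) ^ 2) := by gcongr
      _ = _ := by field_simp; ring
  have hshift : ∀ {k : ℕ}, 1 < k → Summable fun l : ℕ => 1 / (2 * ((l + K : ℕ) : ℝ) + 1) ^ k :=
    fun hk => (summable_nat_add_iff K).2 (summable_one_div_odd_pow hk)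
  have s2 := (hshift (k := 2) (by norm_num)).mul_left (25 / (48 * X))
  have s4 := (hshift (k := 4) (by norm_num)).mul_left (Real.pi ^ 2 / 6)
  have s6 := (hshift (k := 6) (by norm_num)).mul_left (Real.pi ^ 4 / 48 * X)
  have hA := hs.abs
  have h1 : |∑' j, F j| ≤ ∑' j, |F j| := by
    have := norm_tsum_le_tsum_norm (f := F) hs.norm
    simpa only [Real.norm_eq_abs] using this
  have h2 : ∑ j ∈ Finset.range K, |F j| ≤ 5 / 8 * K / X ^ 2 := by
    refine (Finset.sum_le_sum fun j hj => hlow j (Finset.mem_range.1 hj)).trans (le_of_eq ?_)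
    rw [Finset.sum_const, Finset.card_range, nsmul_eq_mul]
    ring
  have h3 : ∑' l, |F (l + K)| ≤
      25 / (48 * X) * ∑' l : ℕ, 1 / (2 * ((l + K : ℕ) : ℝ) + 1) ^ 2
      - Real.pi ^ 2 / 6 * ∑' l : ℕ, 1 / (2 * ((l + K : ℕ) : ℝ) + 1) ^ 4
      + Real.pi ^ 4 / 48 * X * ∑' l : ℕ, 1 / (2 * ((l + K : ℕ) : ℝ) + 1) ^ 6 := by
    rw [← tsum_mul_left, ← tsum_mul_left, ← tsum_mul_left, ← s2.tsum_sub s4,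
      ← (s2.sub s4).tsum_add s6]
    exact ((summable_nat_add_iff K).2 hA).tsum_le_tsum
      (fun l => hhigh (l + K) (Nat.le_add_left _ _)) ((s2.sub s4).add s6)
  have b2 : 25 / (48 * X) * ∑' l : ℕ, 1 / (2 * ((l + K : ℕ) : ℝ) + 1) ^ 2
      ≤ 25 / (48 * X) * (1 / (4 * K)) := by
    gcongr; exact tsum_odd_sq_le hK0
  have b4 : Real.pi ^ 2 / 6 * ((2 * (K : ℝ) + 4) / (6 * (2 * (K : ℝ) + 1) ^ 4)) ≤
      Real.pi ^ 2 / 6 * ∑' l : ℕ, 1 / (2 * ((l + K : ℕ) : ℝ) + 1) ^ 4 := by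
    gcongr; exact le_tsum_odd_pow_four K
  have b6 : Real.pi ^ 4 / 48 * X * ∑' l : ℕ, 1 / (2 * ((l + K : ℕ) : ℝ) + 1) ^ 6
      ≤ Real.pi ^ 4 / 48 * X * (1 / (10 * (2 * (K : ℝ)) ^ 5)) := by
    gcongr; exact tsum_odd_pow_six_le hK0
  have e2 : 25 / (48 * X) * (1 / (4 * (K : ℝ))) = 25 / (192 * X * K) := by
    rw [div_mul_div_comm]; congr 1 <;> ring
  rw [he]
  have h4 := hA.sum_add_tsum_nat_add K
  rw [e2] at b2
  rw [mul_one_div] at b6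
  linarith

/-- The numerical inequality behind the bound for large `X`, with `z = √X` and `w` the even
integer nearest to `z`. -/
lemma large_range_numerics {z w : ℝ} (hz : 20 ≤ z) (h1 : z - 1 < w) (h2 : w ≤ z + 1) :
    5 / 16 * w / z ^ 4 + 25 / (96 * z ^ 2 * w)
      - Real.pi ^ 2 / 6 * ((w + 4) / (6 * (w + 1) ^ 4))
      + Real.pi ^ 4 / 48 * z ^ 2 / (10 * w ^ 5) ≤ 0.534 / z ^ 3 := by
  have hw : 19 < w := by linarith
  have hw0 : 0 < w := by linarith
  have hz0 : 0 < z := by linarith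
  have hq : 0.98 / w ^ 3 ≤ (w + 4) / (w + 1) ^ 4 := by
    rw [div_le_div_iff₀ (by positivity) (by positivity)]
    have : 0.98 * (w + 1) ^ 4 ≤ (w + 4) * w ^ 3 := by
      have : 0 ≤ w ^ 3 := by positivity
      nlinarith [mul_pos hw0 hw0, mul_pos (mul_pos hw0 hw0) hw0,
        mul_nonneg (sub_nonneg.2 hw.le) (mul_pos (mul_pos hw0 hw0) hw0).le,
        mul_nonneg (sub_nonneg.2 hw.le) (mul_pos hw0 hw0).le]
    linarith
  have hp4 : Real.pi ^ 4 ≤ 97.41 := by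
    have := pi_sq_lt
    have h0 : 0 < Real.pi ^ 2 := by positivity
    nlinarith
  have hA : 0.2686 / w ^ 3 ≤ Real.pi ^ 2 / 6 * ((w + 4) / (6 * (w + 1) ^ 4)) := by
    have e : Real.pi ^ 2 / 6 * ((w + 4) / (6 * (w + 1) ^ 4)) =
        Real.pi ^ 2 / 36 * ((w + 4) / (w + 1) ^ 4) := by field_simp; norm_num
    rw [e]
    calc 0.2686 / w ^ 3 ≤ 9.8696 / 36 * (0.98 / w ^ 3) := by
          rw [← mul_div_assoc]; gcongr; norm_num
      _ ≤ _ := by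
          have := lt_pi_sq
          gcongr
  have hB : Real.pi ^ 4 / 48 * z ^ 2 / (10 * w ^ 5) ≤ 0.203 * z ^ 2 / w ^ 5 := by
    rw [div_le_div_iff₀ (by positivity) (by positivity)]
    have : 0 < z ^ 2 * w ^ 5 := by positivity
    nlinarith
  obtain ⟨s, hs⟩ : ∃ s, s = z / w := ⟨_, rfl⟩
  have hzs : z = s * w := by rw [hs]; field_simp
  have hsl : 0.95 ≤ s := by
    rw [hs, le_div_iff₀ hw0]; linarith
  have hsu : s ≤ 1.053 := by
    rw [hs, div_le_iff₀ hw0]; linarith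
  have hs0 : 0 < s := by linarith
  -- By homogeneity only s = z/w, which is close to 1, remains.
  have hpoly : 5 / 16 + 25 / 96 * s ^ 2 - 0.2686 * s ^ 4 + 0.203 * s ^ 6 ≤ 0.534 * s := by
    obtain ⟨t, rfl⟩ : ∃ t, s = 1 + t := ⟨s - 1, by ring⟩
    have ht1 : -0.05 ≤ t := by linarith
    have ht2 : t ≤ 0.053 := by linarith
    -- The quartic multiplies a negative factor, so its tangent line lowers the degree to three.
    have h4 : 1 + 4 * t ≤ (1 + t) ^ 4 := by
      nlinarith [mul_nonneg (sq_nonneg t) hs0.le, sq_nonneg (t ^ 2), sq_nonneg t]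
    have hneg : 0.203 * (1 + t) ^ 2 - 0.2686 ≤ 0 := by nlinarith
    have h5 : (1 + t) ^ 4 * (0.203 * (1 + t) ^ 2 - 0.2686) ≤
        (1 + 4 * t) * (0.203 * (1 + t) ^ 2 - 0.2686) := mul_le_mul_of_nonpos_right h4 hneg
    have h6 : t ^ 2 ≤ 0.0029 := by nlinarith
    have h7 : t ^ 3 ≤ 0.0029 * 0.053 := by
      have : t ^ 2 * t ≤ 0.0029 * 0.053 := by nlinarith [sq_nonneg t]
      linarith [show t ^ 2 * t = t ^ 3 by ring]
    linarith [show (1 + t) ^ 4 * (0.203 * (1 + t) ^ 2 - 0.2686) =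
      0.203 * (1 + t) ^ 6 - 0.2686 * (1 + t) ^ 4 by ring]
  have hfin : 5 / 16 * w / z ^ 4 + 25 / (96 * z ^ 2 * w) - 0.2686 / w ^ 3
      + 0.203 * z ^ 2 / w ^ 5 - 0.534 / z ^ 3 =
      (5 / 16 + 25 / 96 * s ^ 2 - 0.2686 * s ^ 4 + 0.203 * s ^ 6 - 0.534 * s) / (s ^ 4 * w ^ 3) := by
    rw [hzs]; field_simp
  have : (5 / 16 + 25 / 96 * s ^ 2 - 0.2686 * s ^ 4 + 0.203 * s ^ 6 - 0.534 * s) / (s ^ 4 * w ^ 3)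
      ≤ 0 := div_nonpos_of_nonpos_of_nonneg (by linarith) (by positivity)
  linarith

lemma abs_squarefreeTail_two_le_of_large {X : ℝ} (hX : 400 ≤ X) :
    |squarefreeTail {2} X - 4 / Real.pi ^ 2 / X| ≤ 0.534 / X ^ (3 / 2 : ℝ) := by
  have hX0 : 0 < X := by linarith
  obtain ⟨K, hK, h1, h2⟩ := exists_lt_odd_iff (Real.sqrt_nonneg X)
  have hz : 20 ≤ Real.sqrt X := Real.le_sqrt_of_sq_le (by linarith)
  have hK0 : 0 < K := by
    by_contra h
    have : K = 0 := by omega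
    subst this
    norm_num at h2
    linarith
  have h3 := abs_squarefreeTail_two_le_of_odd_count (by linarith) hK0 hK
  have h4 := large_range_numerics hz (w := 2 * K) (by linarith) (by linarith)
  have e : X ^ (3 / 2 : ℝ) = Real.sqrt X ^ 3 := by
    rw [Real.sqrt_eq_rpow, ← Real.rpow_natCast, ← Real.rpow_mul hX0.le]; norm_num
  have e2 : Real.sqrt X ^ 2 = X := Real.sq_sqrt hX0.le
  have e4 : Real.sqrt X ^ 4 = X ^ 2 := by
    rw [show (4 : ℕ) = 2 * 2 from rfl, pow_mul, e2]
  rw [e]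
  rw [e4, e2] at h4
  refine h3.trans (le_of_eq_of_le ?_ h4)
  congr 3
  · ring
  · congr 1; ring

/-! ### The range 1 ≤ X < 400, by finite computation. -/

lemma rpow_three_halves {X : ℝ} (hX : 0 < X) : X ^ (3 / 2 : ℝ) = X * Real.sqrt X := by
  rw [show (3 / 2 : ℝ) = 1 + 1 / 2 by norm_num, Real.rpow_add hX, Real.rpow_one, Real.sqrt_eq_rpow]

lemma abs_sub_div_le_of_abs_mul_sqrt_le {S A X c : ℝ} (hX : 0 < X)
    (h : |S * X - A| * Real.sqrt X ≤ c) : |S - A / X| ≤ c / X ^ (3 / 2 : ℝ) := by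
  rw [rpow_three_halves hX, le_div_iff₀ (by positivity)]
  have e : S * X - A = (S - A / X) * X := by field_simp
  rw [e, abs_mul, abs_of_pos hX, mul_assoc] at h
  exact h

/-- The Möbius expansion at X = 0 has every inner tail equal to π²/8, giving (π²/8)(96/π⁴). -/
lemma squarefreeTail_two_of_lt_one {X : ℝ} (hX : X < 1) :
    squarefreeTail {2} X = 12 / Real.pi ^ 2 := by
  have h0 : squarefreeTail {2} X = squarefreeTail {2} 0 := by
    rw [squarefreeTail_two, squarefreeTail_two]
    refine tsum_congr fun l => ?_
    have : (0 : ℝ) ≤ l := by positivity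
    rw [if_pos (by linarith), if_pos (by linarith)]
  rw [h0, squarefreeTail_two_eq_tsum]
  simp only [zero_div, oddTail_of_lt_one zero_lt_one]
  rw [tsum_mul_right, tsum_moebius_odd_div_pow_four]
  have : (0 : ℝ) < Real.pi := Real.pi_pos
  field_simp
  norm_num

/-- The sum of `μ²(m) / m²` over the first `K` odd integers. -/
noncomputable def oddSquarefreeSum (K : ℕ) : ℝ :=
  ∑ j ∈ Finset.range K, (moebius (2 * j + 1) : ℝ) ^ 2 / (2 * (j : ℝ) + 1) ^ 2

lemma summable_odd_moebius_sq :
    Summable fun j : ℕ => (moebius (2 * j + 1) : ℝ) ^ 2 / (2 * (j : ℝ) + 1) ^ 2 :=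
  (summable_moebius_sq_div.comp_injective injective_two_mul_add_one).congr fun j => by simp

lemma squarefreeTail_two_eq_sub {X : ℝ} {K : ℕ} (hK : ∀ l : ℕ, X < 2 * (l : ℝ) + 1 ↔ K ≤ l) :
    squarefreeTail {2} X = 12 / Real.pi ^ 2 - oddSquarefreeSum K := by
  have h1 := summable_odd_moebius_sq.sum_add_tsum_nat_add K
  have h2 : squarefreeTail {2} 0 = ∑' j : ℕ, (moebius (2 * j + 1) : ℝ) ^ 2 / (2 * (j : ℝ) + 1) ^ 2 := by
    rw [squarefreeTail_two]
    refine tsum_congr fun l => ?_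
    rw [if_pos (by positivity)]
  rw [← h2, squarefreeTail_two_of_lt_one zero_lt_one] at h1
  rw [squarefreeTail_two, ← h1, oddSquarefreeSum, add_sub_cancel_left,
    ← tsum_ite_le_eq (fun j : ℕ => (moebius (2 * j + 1) : ℝ) ^ 2 / (2 * (j : ℝ) + 1) ^ 2)]
  exact tsum_congr fun l => if_congr (hK l) rfl rfl

/-- Whether no square of an odd prime below `23` divides `n`. -/
def oddSquarefreeTest (n : ℕ) : Bool :=
  [3, 5, 7, 11, 13, 17, 19].all fun p => n % (p * p) != 0

lemma oddSquarefreeTest_iff {j : ℕ} (hj : j < 264) :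
    oddSquarefreeTest (2 * j + 1) = true ↔ Squarefree (2 * j + 1) := by
  rw [Nat.squarefree_iff_prime_squarefree]
  simp only [oddSquarefreeTest, List.all_cons, List.all_nil, Bool.and_true, Bool.and_eq_true,
    bne_iff_ne, ne_eq, ← Nat.dvd_iff_mod_eq_zero]
  constructor
  · rintro ⟨h3, h5, h7, h11, h13, h17, h19⟩ p hp hd
    -- Here 2j + 1 ≤ 527 < 23².
    have hlt : p < 23 := by
      by_contra h
      have h1 := Nat.le_of_dvd (by omega) hd
      have h2 : 23 * 23 ≤ p * p := Nat.mul_le_mul (by omega) (by omega)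
      omega
    have h2 : p ≠ 2 := by
      rintro rfl
      omega
    interval_cases p <;> contradiction
  · intro h
    exact ⟨h 3 (by norm_num), h 5 (by norm_num), h 7 (by norm_num), h 11 (by norm_num),
      h 13 (by norm_num), h 17 (by norm_num), h 19 (by norm_num)⟩

/-- Fixed-point test (denominator `10 ^ 9`) of the tail estimate on `[2K - 1, 2K + 1)`,
given a lower approximation `a` of `oddSquarefreeSum K`. -/
def tailTest (K a : ℤ) : Bool :=
  -- U and V bound, in units of 10⁻⁹, the two signs of S·X - 4/π², taken at the right and left ends
  -- of the interval. The slack a + K allows one unit of rounding for each of the K terms.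
  let U := (12 * 101321230 - a) * (2 * K + 1) - 4 * 101321120
  let V := 4 * 101321230 - (12 * 101321120 - (a + K)) * (2 * K - 1)
  (decide (U ≤ 0) || decide (1000 * (U * U * (2 * K + 1)) ≤ 285 * 10 ^ 18)) &&
  (decide (V ≤ 0) || decide (1000 * (V * V * (2 * K + 1)) ≤ 285 * 10 ^ 18))

/-- The fixed-point tests for `n` consecutive intervals. -/
def tailTests : ℕ → ℕ → ℕ → Bool
  | 0, _, _ => true
  | n + 1, K, a => tailTest K a && tailTests n (K + 1)
      (a + if oddSquarefreeTest (2 * K + 1) then 10 ^ 9 / (2 * K + 1) ^ 2 else 0)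

lemma inv_pi_sq_bounds : 101321120 / 10 ^ 9 ≤ 1 / Real.pi ^ 2 ∧
    1 / Real.pi ^ 2 ≤ 101321230 / 10 ^ 9 := by
  have h1 := pi_sq_lt
  have h2 := lt_pi_sq
  have h0 : 0 < Real.pi ^ 2 := by positivity
  constructor
  · rw [div_le_div_iff₀ (by positivity) h0]; linarith
  · rw [div_le_div_iff₀ h0 (by positivity)]; linarith

lemma mul_sqrt_le_of_test {U N : ℤ} {x X : ℝ} (hX : 0 ≤ X) (hXN : X ≤ N) (hx : x ≤ U / 10 ^ 9)
    (h : (decide (U ≤ 0) || decide (1000 * (U * U * N) ≤ 285 * 10 ^ 18)) = true) :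
    x * Real.sqrt X ≤ 0.534 := by
  have hs := Real.sqrt_nonneg X
  rw [Bool.or_eq_true, decide_eq_true_eq, decide_eq_true_eq] at h
  rcases le_or_gt (U : ℤ) 0 with hU | hU
  · have : (U : ℝ) ≤ 0 := by exact_mod_cast hU
    have : x ≤ 0 := hx.trans (div_nonpos_of_nonpos_of_nonneg this (by positivity))
    nlinarith
  · have h2 : 1000 * (U * U * N) ≤ 285 * 10 ^ 18 := h.resolve_left (by omega)
    have h3 : (1000 : ℝ) * (U * U * N) ≤ 285 * 10 ^ 18 := by exact_mod_cast h2
    have hU0 : (0 : ℝ) < U := by exact_mod_cast hU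
    have h4 : x * Real.sqrt X ≤ U / 10 ^ 9 * Real.sqrt N := by gcongr
    -- The tested bound suffices after squaring because 0.285 ≤ 0.534².
    refine h4.trans (abs_le_of_sq_le_sq' ?_ (by norm_num)).2
    rw [mul_pow, Real.sq_sqrt (hX.trans hXN), div_pow, div_mul_eq_mul_div, div_le_iff₀ (by positivity)]
    norm_num
    linarith

lemma abs_le_of_tailTest {K a : ℕ} (hK : 1 ≤ K) (h : tailTest K a = true) {q X : ℝ}
    (h1 : (a : ℝ) / 10 ^ 9 ≤ q) (h2 : q ≤ (a + K) / 10 ^ 9) (hq : 0 ≤ 12 / Real.pi ^ 2 - q)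
    (hX1 : 2 * (K : ℝ) - 1 ≤ X) (hX2 : X < 2 * K + 1) :
    |(12 / Real.pi ^ 2 - q) - 4 / Real.pi ^ 2 / X| ≤ 0.534 / X ^ (3 / 2 : ℝ) := by
  have hK1 : (1 : ℝ) ≤ K := by exact_mod_cast hK
  have hX : 0 < X := by linarith
  obtain ⟨u0, u1⟩ := inv_pi_sq_bounds
  obtain ⟨u, hu⟩ : ∃ u, u = 1 / Real.pi ^ 2 := ⟨_, rfl⟩
  have e12 : 12 / Real.pi ^ 2 = 12 * u := by rw [hu]; ring
  have e4 : 4 / Real.pi ^ 2 = 4 * u := by rw [hu]; ring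
  rw [← hu] at u0 u1
  rw [e12] at hq
  rw [e12, e4]
  refine abs_sub_div_le_of_abs_mul_sqrt_le hX ?_
  simp only [tailTest, Bool.and_eq_true] at h
  have hXN : X ≤ ((2 * (K : ℤ) + 1 : ℤ) : ℝ) := by push_cast; exact hX2.le
  have b1 : ((12 * u - q) * X - 4 * u) * Real.sqrt X ≤ 0.534 := by
    refine mul_sqrt_le_of_test hX.le hXN ?_ h.1
    have : (12 * u - q) * X ≤ (12 * u - q) * (2 * K + 1) := by gcongr
    have : (12 * u - q) * (2 * K + 1) ≤
        (12 * (101321230 / 10 ^ 9) - a / 10 ^ 9) * (2 * (K : ℝ) + 1) := by gcongr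
    push_cast
    linarith
  have b2 : (4 * u - (12 * u - q) * X) * Real.sqrt X ≤ 0.534 := by
    refine mul_sqrt_le_of_test hX.le hXN ?_ h.2
    have : (12 * u - q) * (2 * K - 1) ≤ (12 * u - q) * X := by gcongr
    have : (12 * (101321120 / 10 ^ 9) - (a + K) / 10 ^ 9) * (2 * (K : ℝ) - 1) ≤
        (12 * u - q) * (2 * K - 1) := by
      apply mul_le_mul_of_nonneg_right _ (by linarith)
      linarith
    push_cast
    linarith
  have e : |(12 * u - q) * X - 4 * u| * Real.sqrt X = |((12 * u - q) * X - 4 * u) * Real.sqrt X| := by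
    rw [abs_mul, abs_of_nonneg (Real.sqrt_nonneg X)]
  rw [e, abs_le]
  exact ⟨by linarith, b1⟩

lemma exists_tailTest_of_tailTests {n K a : ℕ} (hn : K + n ≤ 264) (h : tailTests n K a = true)
    (h1 : (a : ℝ) / 10 ^ 9 ≤ oddSquarefreeSum K) (h2 : oddSquarefreeSum K ≤ (a + K) / 10 ^ 9)
    {L : ℕ} (hL1 : K ≤ L) (hL2 : L < K + n) :
    ∃ b : ℕ, tailTest L b = true ∧ (b : ℝ) / 10 ^ 9 ≤ oddSquarefreeSum L ∧
      oddSquarefreeSum L ≤ (b + L) / 10 ^ 9 := by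
  induction n generalizing K a with
  | zero => omega
  | succ n ih =>
    rw [tailTests, Bool.and_eq_true] at h
    rcases hL1.eq_or_lt with rfl | hlt
    · exact ⟨a, h.1, h1, h2⟩
    refine ih (by omega) h.2 ?_ ?_ (by omega) (by omega)
    all_goals
      rw [oddSquarefreeSum, Finset.sum_range_succ, ← oddSquarefreeSum, moebius_sq_cast]
      have hiff := oddSquarefreeTest_iff (j := K) (by omega)
      have hd0 : (0 : ℝ) < (2 * (K : ℝ) + 1) ^ 2 := by positivity
      by_cases hs : Squarefree (2 * K + 1)
      · rw [if_pos hs, if_pos (hiff.2 hs)]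
        obtain ⟨c, hc⟩ : ∃ c, c = 10 ^ 9 / (2 * K + 1) ^ 2 := ⟨_, rfl⟩
        have c1 : ((2 * (K : ℝ) + 1) ^ 2) * c ≤ 10 ^ 9 := by
          have := Nat.mul_div_le (10 ^ 9) ((2 * K + 1) ^ 2)
          rw [← hc] at this
          exact_mod_cast this
        have c2 : (10 : ℝ) ^ 9 ≤ ((2 * (K : ℝ) + 1) ^ 2) * (c + 1) := by
          have := (Nat.lt_mul_div_succ (10 ^ 9) (show 0 < (2 * K + 1) ^ 2 by positivity)).le
          rw [← hc] at this
          exact_mod_cast this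
        rw [← hc]
        have d1 : (c : ℝ) / 10 ^ 9 ≤ 1 / (2 * (K : ℝ) + 1) ^ 2 := by
          rw [div_le_div_iff₀ (by positivity) hd0]; linarith
        have d2 : 1 / (2 * (K : ℝ) + 1) ^ 2 ≤ ((c : ℝ) + 1) / 10 ^ 9 := by
          rw [div_le_div_iff₀ hd0 (by positivity)]; linarith
        push_cast
        linarith
      · rw [if_neg hs, if_neg (fun h => hs (hiff.1 h)), zero_div]
        push_cast
        linarith

lemma tailTests_eq_true : tailTests 200 1 (10 ^ 9) = true := by decide +kernel

lemma abs_squarefreeTail_two_le {X : ℝ} (hX : 1 ≤ X) :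
    |squarefreeTail {2} X - 4 / Real.pi ^ 2 / X| ≤ 0.534 / X ^ (3 / 2 : ℝ) := by
  rcases le_or_gt 400 X with h | h
  · exact abs_squarefreeTail_two_le_of_large h
  obtain ⟨K, hK, h1, h2⟩ := exists_lt_odd_iff (show 0 ≤ X by linarith)
  have hK1 : 1 ≤ K := by
    have : (0 : ℝ) < K := by linarith
    exact_mod_cast this
  have hK2 : K < 201 := by
    have : (K : ℝ) < 201 := by linarith
    exact_mod_cast this
  have e1 : oddSquarefreeSum 1 = 1 := by simp [oddSquarefreeSum]
  obtain ⟨b, hb, hb1, hb2⟩ := exists_tailTest_of_tailTests (L := K) (by norm_num) tailTests_eq_true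
    (by rw [e1]; norm_num) (by rw [e1]; norm_num) hK1 (by omega)
  have e := squarefreeTail_two_eq_sub hK
  rw [e]
  exact abs_le_of_tailTest hK1 hb hb1 hb2 (e ▸ squarefreeTail_nonneg _ _) h1 h2

/-! ### The two base cases and the general modulus. -/

/-- The constant is governed by X → 1⁻, where the normalised error tends to 8/π² < 0.812; for X ≥ 1
the bound 0.534 is ample. -/
lemma squarefreeTail_two_bound {X : ℝ} (hX : 0 < X) :
    |squarefreeTail {2} X - 4 / Real.pi ^ 2 / X|
      ≤ 0.238 / (1 - 1 / (2 : ℝ) ^ (1 / 2 : ℝ)) / X ^ (3 / 2 : ℝ) := by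
  have h2 : (1.414 : ℝ) ≤ Real.sqrt 2 := Real.le_sqrt_of_sq_le (by norm_num)
  have hc : 0.812 ≤ 0.238 / (1 - 1 / (2 : ℝ) ^ (1 / 2 : ℝ)) := by
    rw [← Real.sqrt_eq_rpow]
    have h3 : 1 / Real.sqrt 2 = Real.sqrt 2 / 2 := by
      rw [div_eq_div_iff (by positivity) (by positivity), Real.mul_self_sqrt (by norm_num)]; ring
    have h4 : Real.sqrt 2 < 2 := by rw [Real.sqrt_lt' (by norm_num)]; norm_num
    rw [h3, le_div_iff₀ (by linarith)]
    linarith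
  have hgoal : |squarefreeTail {2} X - 4 / Real.pi ^ 2 / X| ≤ 0.812 / X ^ (3 / 2 : ℝ) := by
    rcases le_or_gt 1 X with h | h
    · refine (abs_squarefreeTail_two_le h).trans ?_
      gcongr
      norm_num
    · refine abs_sub_div_le_of_abs_mul_sqrt_le hX ?_
      rw [squarefreeTail_two_of_lt_one h]
      have hs : Real.sqrt X ≤ 1 := Real.sqrt_le_one.2 h.le
      obtain ⟨u0, u1⟩ := inv_pi_sq_bounds
      have e12 : 12 / Real.pi ^ 2 = 12 * (1 / Real.pi ^ 2) := by ring
      have e4 : 4 / Real.pi ^ 2 = 4 * (1 / Real.pi ^ 2) := by ring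
      have : |12 / Real.pi ^ 2 * X - 4 / Real.pi ^ 2| ≤ 0.812 := by
        rw [e12, e4, abs_le]
        constructor <;> nlinarith
      calc _ ≤ 0.812 * (1 : ℝ) := by gcongr
        _ = _ := mul_one _
  refine hgoal.trans ?_
  gcongr

lemma squarefreeTail_empty_eq (X : ℝ) :
    squarefreeTail ∅ X = squarefreeTail {2} X + 1 / 4 * squarefreeTail {2} (X / 2) := by
  have := squarefreeTail_split (P := ∅) (by simp) Nat.prime_two (by simp) X
  rw [this]
  norm_num

/-- For X ≥ 2 both X and X/2 are at least 1, and 0.534(1 + √2/2) < 0.912. As X → 1⁻ the normalised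
error tends to 9/π², just below 0.912. -/
lemma squarefreeTail_empty_bound {X : ℝ} (hX : 0 < X) :
    |squarefreeTail ∅ X - 6 / Real.pi ^ 2 / X| ≤ 0.912 / X ^ (3 / 2 : ℝ) := by
  obtain ⟨u0, u1⟩ := inv_pi_sq_bounds
  obtain ⟨u, hu⟩ : ∃ u, u = 1 / Real.pi ^ 2 := ⟨_, rfl⟩
  have e12 : 12 / Real.pi ^ 2 = 12 * u := by rw [hu]; ring
  have e6 : 6 / Real.pi ^ 2 = 6 * u := by rw [hu]; ring
  have e4 : 4 / Real.pi ^ 2 = 4 * u := by rw [hu]; ring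
  rw [← hu] at u0 u1
  have heq := squarefreeTail_empty_eq X
  rcases lt_or_ge X 1 with h1 | h1
  · rw [squarefreeTail_two_of_lt_one h1, squarefreeTail_two_of_lt_one (by linarith)] at heq
    refine abs_sub_div_le_of_abs_mul_sqrt_le hX ?_
    rw [heq, e12, e6]
    have hs : Real.sqrt X ≤ 1 := Real.sqrt_le_one.2 h1.le
    have : |(12 * u + 1 / 4 * (12 * u)) * X - 6 * u| ≤ 0.912 := by
      rw [abs_le]
      constructor <;> nlinarith
    calc _ ≤ 0.912 * (1 : ℝ) := by gcongr
      _ = _ := mul_one _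
  rcases lt_or_ge X 2 with h2 | h2
  · have hK : ∀ l : ℕ, X < 2 * (l : ℝ) + 1 ↔ 1 ≤ l := by
      intro l
      constructor
      · intro h
        by_contra h0
        have : l = 0 := by omega
        subst this
        norm_num at h
        linarith
      · intro h
        have : (1 : ℝ) ≤ l := by exact_mod_cast h
        linarith
    rw [squarefreeTail_two_eq_sub hK, squarefreeTail_two_of_lt_one (by linarith),
      show oddSquarefreeSum 1 = 1 by simp [oddSquarefreeSum]] at heq
    refine abs_sub_div_le_of_abs_mul_sqrt_le hX ?_
    rw [heq, e12, e6]
    have hs : Real.sqrt X ≤ 2 := by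
      rw [Real.sqrt_le_left (by norm_num)]; linarith
    have : |(12 * u - 1 + 1 / 4 * (12 * u)) * X - 6 * u| ≤ 0.456 := by
      rw [abs_le]
      constructor <;> nlinarith
    calc _ ≤ 0.456 * (2 : ℝ) := by gcongr
      _ = _ := by norm_num
  · have b1 := abs_squarefreeTail_two_le h1
    have b2 := abs_squarefreeTail_two_le (X := X / 2) (by linarith)
    have e : squarefreeTail ∅ X - 6 / Real.pi ^ 2 / X =
        (squarefreeTail {2} X - 4 / Real.pi ^ 2 / X) +
        1 / 4 * (squarefreeTail {2} (X / 2) - 4 / Real.pi ^ 2 / (X / 2)) := by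
      rw [heq]; field_simp; ring
    have hs2 : Real.sqrt 2 ≤ 1.4143 := by
      rw [Real.sqrt_le_left (by norm_num)]; norm_num
    have e2 : 0.534 / (X / 2) ^ (3 / 2 : ℝ) = 0.534 * (2 * Real.sqrt 2) / X ^ (3 / 2 : ℝ) := by
      rw [Real.div_rpow hX.le (by norm_num), rpow_three_halves two_pos, div_div_eq_mul_div]
    rw [e2] at b2
    rw [e]
    calc _ ≤ |squarefreeTail {2} X - 4 / Real.pi ^ 2 / X| +
          1 / 4 * |squarefreeTail {2} (X / 2) - 4 / Real.pi ^ 2 / (X / 2)| := by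
          refine (abs_add_le _ _).trans ?_
          rw [abs_mul, abs_of_pos (show (0 : ℝ) < 1 / 4 by norm_num)]
      _ ≤ 0.534 / X ^ (3 / 2 : ℝ) + 1 / 4 * (0.534 * (2 * Real.sqrt 2) / X ^ (3 / 2 : ℝ)) := by gcongr
      _ = (0.534 * (1 + Real.sqrt 2 / 2)) / X ^ (3 / 2 : ℝ) := by ring
      _ ≤ _ := by
          gcongr
          linarith

lemma tsum_coprime_eq_squarefreeTail {q : ℕ} (hq : 0 < q) (X : ℝ) :
    (∑' ℓ : {ℓ : ℕ // X < (ℓ : ℝ) ∧ Nat.Coprime ℓ q},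
      (moebius (ℓ : ℕ) : ℝ) ^ 2 / ((ℓ : ℕ) : ℝ) ^ 2) = squarefreeTail q.primeFactors X := by
  have e : {ℓ : ℕ | X < (ℓ : ℝ) ∧ Nat.Coprime ℓ q} =
      {n : ℕ | X < n ∧ ∀ p ∈ q.primeFactors, ¬ p ∣ n} := by
    ext n
    refine and_congr_right fun _ => ?_
    rw [Nat.coprime_comm]
    constructor
    · intro h p hp hpn
      exact (Nat.prime_of_mem_primeFactors hp).not_dvd_one
        (h ▸ Nat.dvd_gcd (Nat.dvd_of_mem_primeFactors hp) hpn)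
    · intro h
      refine Nat.coprime_of_dvd fun p hp hpq hpn => h p ?_ hpn
      exact Nat.mem_primeFactors.2 ⟨hp, hpq, hq.ne'⟩
  rw [squarefreeTail, ← e]
  exact tsum_subtype {ℓ : ℕ | X < (ℓ : ℝ) ∧ Nat.Coprime ℓ q}
    (fun n : ℕ => (moebius n : ℝ) ^ 2 / (n : ℝ) ^ 2)

lemma div_kappa_one {q : ℕ} (hq : 0 < q) :
    (q : ℝ) / kappa 1 q = 1 / ∏ p ∈ q.primeFactors, (1 + 1 / (p : ℝ)) := by
  have : (0 : ℝ) < q := by exact_mod_cast hq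
  simp only [kappa, Real.rpow_one]
  rw [div_mul_cancel_left₀ this.ne', one_div]

lemma sqrt_div_eulerPhi_half {q : ℕ} (hq : 0 < q) :
    Real.sqrt q / eulerPhi (1 / 2) q =
      1 / ∏ p ∈ q.primeFactors, (1 - 1 / (p : ℝ) ^ (1 / 2 : ℝ)) := by
  have : (0 : ℝ) < q := by exact_mod_cast hq
  rw [eulerPhi, Real.sqrt_eq_rpow, div_mul_cancel_left₀ (by positivity)]
  exact (one_div _).symm

theorem corollary4p3 (q : ℕ) (hq : 0 < q) (X : ℝ) (hX : 0 < X) :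
    Summable (fun ℓ : {ℓ : ℕ // X < (ℓ : ℝ) ∧ Nat.Coprime ℓ q} =>
      (ArithmeticFunction.moebius (ℓ : ℕ) : ℝ) ^ 2 / ((ℓ : ℕ) : ℝ) ^ 2) ∧
    (¬ 2 ∣ q →
      |(∑' ℓ : {ℓ : ℕ // X < (ℓ : ℝ) ∧ Nat.Coprime ℓ q},
          (ArithmeticFunction.moebius (ℓ : ℕ) : ℝ) ^ 2 / ((ℓ : ℕ) : ℝ) ^ 2)
        - (q : ℝ) / kappa 1 q * (6 / Real.pi ^ 2) * (1 / X)|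
      ≤ Real.sqrt q / eulerPhi (1 / 2) q * (0.912 / X ^ (3 / 2 : ℝ))) ∧
    (2 ∣ q →
      |(∑' ℓ : {ℓ : ℕ // X < (ℓ : ℝ) ∧ Nat.Coprime ℓ q},
          (ArithmeticFunction.moebius (ℓ : ℕ) : ℝ) ^ 2 / ((ℓ : ℕ) : ℝ) ^ 2)
        - (q : ℝ) / kappa 1 q * (6 / Real.pi ^ 2) * (1 / X)|
      ≤ Real.sqrt q / eulerPhi (1 / 2) q * (0.238 / X ^ (3 / 2 : ℝ))) := by
  rw [tsum_coprime_eq_squarefreeTail hq, div_kappa_one hq, sqrt_div_eulerPhi_half hq]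
  have hprime : ∀ r ∈ q.primeFactors, r.Prime := fun r hr => Nat.prime_of_mem_primeFactors hr
  refine ⟨summable_moebius_sq_div.subtype {ℓ : ℕ | X < (ℓ : ℝ) ∧ Nat.Coprime ℓ q}, fun _ => ?_,
    fun h2 => ?_⟩
  · have h := squarefreeTail_union_bound (P := ∅) (by simp)
      (fun X hX => squarefreeTail_empty_bound hX) q.primeFactors hprime (by simp) X hX
    rw [Finset.empty_union] at h
    convert h using 1
    · congr 2; ring
    · ring
  · have hmem : 2 ∈ q.primeFactors := Nat.mem_primeFactors.2 ⟨Nat.prime_two, h2, hq.ne'⟩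
    have h := squarefreeTail_union_bound (P := {2}) (by simp [Nat.prime_two])
      (fun X hX => squarefreeTail_two_bound hX) (q.primeFactors.erase 2)
      (fun r hr => hprime r (Finset.mem_of_mem_erase hr)) (by simp) X hX
    rw [← Finset.insert_eq, Finset.insert_erase hmem] at h
    -- The factors at 2 belong to the base case: (6/π²)/(3/2) = 4/π², and 1 - 2^(-1/2) is already in
    -- its error constant.
    rw [← Finset.mul_prod_erase _ _ hmem, ← Finset.mul_prod_erase _ _ hmem]
    push_cast
    convert h using 1
    · congr 2
      rw [show (1 + 1 / (2 : ℝ)) = 3 / 2 by norm_num]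
      field_simp
      ring
    · rw [one_div_mul_eq_div, div_div, div_div, div_div]
      congr 1
      ring
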